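/- Work in ZFC. A $\Sigma_1$-formula is a formula of the language $\{\in\}$ consisting of a block of existential quantifiers followed by a formula all of whose quantifiers are bounded. A well-ordering $\lhd$ of a set $X$ is a \emph{good $\Sigma_1(y)$-wellordering of $X$} if the set $I(\lhd)=\{\{x\in X : x\lhd z\} : z\in X\}$ of all its proper initial segments is $\Sigma_1(y)$-definable, i.e. $I(\lhd)=\{A : \varphi(A,y)\}$ for some $\Sigma_1$-formula $\varphi(v_0,v_1)$. A cardinal $\delta$ is measurable if it is uncountable and carries a nonprincipal $\delta$-complete ultrafilter. Given cardinals $\delta<\nu$, the cardinal $\nu$ is \emph{$\delta$-inaccessible} if $\lambda^\delta<\nu$ for every cardinal $\lambda<\nu$. \textbf{Lemma.} Let $\delta$ be a measurable cardinal and let $\nu>\delta$ be a $\delta$-inaccessible cardinal with $\operatorname{cof}(\nu)\neq\delta$. If $\kappa$ is a cardinal with $\nu\leq\kappa\leq\nu^+$, then there is no good $\Sigma_1(\kappa)$-wellordering of the power set $\mathcal P(\kappa)$. -/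

import Mathlib

open Cardinal

universe u

namespace SetTheoryGoodWO

/-! ### The language of set theory and the Levy classes of formulas -/

/-- The only symbol of the language of set theory: a binary relation symbol for membership. -/
inductive MemRel : ℕ → Type
  | mem : MemRel 2

/-- The first-order language of set theory (with equality as a logical symbol). -/
def langMem : FirstOrder.Language.{0, 0} := ⟨fun _ => Empty, MemRel⟩

/-- The universe of sets `V`, represented by Mathlib's `ZFSet`, as a structure in the language of
set theory: the symbol `mem` is interpreted by the true membership relation. -/
instance zfsetStructure : langMem.Structure ZFSet.{u} where
  funMap := fun f _ => Empty.elim f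
  RelMap := fun {_} R =>
    match R with
    | MemRel.mem => fun v => v 0 ∈ v 1

section Formulas

variable {α : Type} {n : ℕ}

/-- The atomic formula `a ∈ b`, for variables `a` and `b`. -/
def memF (a b : α ⊕ Fin n) : langMem.BoundedFormula α n :=
  FirstOrder.Language.BoundedFormula.rel (L := langMem) (l := 2) MemRel.mem
    ![FirstOrder.Language.Term.var a, FirstOrder.Language.Term.var b]

/-- The bounded quantification `∀ x ∈ b, φ`, where `x` is the last variable of `φ` and the bound
`b` is a variable different from `x`. -/
def ballF (b : α ⊕ Fin n) (φ : langMem.BoundedFormula α (n + 1)) : langMem.BoundedFormula α n :=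
  ((memF (Sum.inr (Fin.last n)) (Sum.map id Fin.castSucc b)).imp φ).all

/-- The bounded quantification `∃ x ∈ b, φ`, where `x` is the last variable of `φ` and the bound
`b` is a variable different from `x`. -/
def bexF (b : α ⊕ Fin n) (φ : langMem.BoundedFormula α (n + 1)) : langMem.BoundedFormula α n :=
  (memF (Sum.inr (Fin.last n)) (Sum.map id Fin.castSucc b) ⊓ φ).ex

/-- `Δ₀`-formulas: built from atomic formulas by propositional connectives (`⊥` and `→`, through
which Mathlib expresses the others) and bounded quantification. -/
inductive IsDeltaZero : ∀ {n : ℕ}, langMem.BoundedFormula α n → Prop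
  | falsum {n : ℕ} :
      IsDeltaZero (FirstOrder.Language.BoundedFormula.falsum : langMem.BoundedFormula α n)
  | equal {n : ℕ} (t₁ t₂ : langMem.Term (α ⊕ Fin n)) :
      IsDeltaZero (FirstOrder.Language.BoundedFormula.equal t₁ t₂)
  | rel {n l : ℕ} (R : langMem.Relations l) (ts : Fin l → langMem.Term (α ⊕ Fin n)) :
      IsDeltaZero (FirstOrder.Language.BoundedFormula.rel R ts)
  | imp {n : ℕ} {φ ψ : langMem.BoundedFormula α n} :
      IsDeltaZero φ → IsDeltaZero ψ → IsDeltaZero (φ.imp ψ)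
  | ball {n : ℕ} (b : α ⊕ Fin n) {φ : langMem.BoundedFormula α (n + 1)} :
      IsDeltaZero φ → IsDeltaZero (ballF b φ)
  | bex {n : ℕ} (b : α ⊕ Fin n) {φ : langMem.BoundedFormula α (n + 1)} :
      IsDeltaZero φ → IsDeltaZero (bexF b φ)

/-- `Σ₁`-formulas: a (possibly empty) block of unbounded existential quantifiers in front of a
`Δ₀`-formula. -/
inductive IsSigmaOne : ∀ {n : ℕ}, langMem.BoundedFormula α n → Prop
  | of_deltaZero {n : ℕ} {φ : langMem.BoundedFormula α n} : IsDeltaZero φ → IsSigmaOne φ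
  | ex {n : ℕ} {φ : langMem.BoundedFormula α (n + 1)} : IsSigmaOne φ → IsSigmaOne φ.ex

end Formulas

/-! ### Definability and good wellorderings -/

/-- A collection `X` of sets is `Σ₁(y₀, …, yₙ₋₁)`-definable if `X = {x | φ(x, y₀, …, yₙ₋₁)}` for
some `Σ₁`-formula `φ(v₀, …, vₙ)`. -/
def IsSigmaOneDefinable {n : ℕ} (y : Fin n → ZFSet.{u}) (X : Set ZFSet.{u}) : Prop :=
  ∃ φ : langMem.Formula (Fin (n + 1)), IsSigmaOne φ ∧
    X = {x | φ.Realize (Fin.cons x y : Fin (n + 1) → ZFSet.{u})}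

/-- The proper initial segment `{x ∈ X | x ◁ y}`, as a set. -/
noncomputable def initialSegment {X : ZFSet.{u}} (r : X → X → Prop) (y : X) : ZFSet.{u} :=
  ZFSet.sep (fun x => ∃ hx : x ∈ X, r ⟨x, hx⟩ y) X

/-- The collection `I(◁) = {{x ∈ X | x ◁ y} | y ∈ X}` of all proper initial segments of `◁`. -/
def initialSegments {X : ZFSet.{u}} (r : X → X → Prop) : Set ZFSet.{u} :=
  {A | ∃ y : X, A = initialSegment r y}

/-- `◁` is a good `Σ₁(y₀, …, yₙ₋₁)`-wellordering of the set `X`: it is a (strict) wellordering of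
`X`, and the collection of its proper initial segments is `Σ₁(y₀, …, yₙ₋₁)`-definable. -/
structure IsGoodSigmaOneWellOrdering {n : ℕ} (y : Fin n → ZFSet.{u}) (X : ZFSet.{u})
    (r : X → X → Prop) : Prop where
  isWellOrder : IsWellOrder X r
  definable : IsSigmaOneDefinable y (initialSegments r)

/-! ### Cardinals -/

/-- `δ` is a measurable cardinal: it is uncountable and there is a nonprincipal `δ`-complete
ultrafilter on (a set of cardinality) `δ`. -/
def IsMeasurableCardinal (δ : Cardinal.{u}) : Prop :=
  ℵ₀ < δ ∧ ∃ U : Ultrafilter δ.out,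
    CardinalInterFilter (U : Filter δ.out) δ ∧ ∀ a : δ.out, U ≠ pure a

/-- `ν` is `δ`-inaccessible: `δ < ν` and `μ ^ δ < ν` for all cardinals `μ < ν`. -/
def IsInaccessibleRelTo (δ ν : Cardinal.{u}) : Prop :=
  δ < ν ∧ ∀ μ : Cardinal.{u}, μ < ν → μ ^ δ < ν

/-- A cardinal as a set: the von Neumann ordinal which is its initial ordinal. -/
noncomputable def cardToZFSet (κ : Cardinal.{u}) : ZFSet.{u} := κ.ord.toZFSet

end SetTheoryGoodWO

/-! Let `j` be the embedding of the universe into the transitive collapse `M` of its ultrapower by a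
nonprincipal `δ`-complete ultrafilter on `δ`. Counting representing functions shows that `j` fixes
`κ`. By Łoś and upward absoluteness from `M`, a `Σ₁(κ)`-definable collection contains the `j`-image
of each of its members, so `j` sends proper initial segments of a good wellordering to proper
initial segments. As `j` preserves the order, no `x` lies above `j(x)`. Hence if `x ◁ y`, then `x`
lies in the segment `j({w | w ◁ y})`, a member of `M`, so `x ∈ M` (`exists_ultraVal_eq_of_lt`). Thus
`M` omits at most the last element of `𝒫(κ)`. But `B = j''δ⁺ ⊆ κ` is not in `M`
(`ne_ultraVal_image`), so neither is `κ \ B`, and these two cannot both be last. -/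

namespace SetTheoryGoodWO

open FirstOrder FirstOrder.Language Filter

/-! ### The ultrapower of the universe and its transitive collapse -/

section Collapse

variable {I : Type u} {U : Ultrafilter I}

/-- The ultrapower of the universe of sets by `U`. -/
abbrev Ultrapower (U : Ultrafilter I) : Type (u + 1) :=
  (U : Filter I).Product (fun _ => ZFSet.{u})

/-- The class in the ultrapower of a function. -/
def Ultrapower.mk (U : Ultrafilter I) (f : I → ZFSet.{u}) : Ultrapower U :=
  (f : (U : Filter I).Product (fun _ => ZFSet.{u}))

theorem Ultrapower.ind {p : Ultrapower U → Prop} (h : ∀ f, p (Ultrapower.mk U f)) (x) : p x :=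
  Quotient.inductionOn x h

theorem Ultrapower.mk_eq_mk {f g : I → ZFSet.{u}} :
    Ultrapower.mk U f = Ultrapower.mk U g ↔ ∀ᶠ a in U, f a = g a :=
  Quotient.eq''

/-- The membership relation of the ultrapower. -/
def Ultrapower.Mem (x y : Ultrapower U) : Prop :=
  Structure.RelMap (L := langMem) (M := Ultrapower U) (n := 2) MemRel.mem ![x, y]

theorem Ultrapower.mem_mk {f g : I → ZFSet.{u}} :
    (Ultrapower.mk U f).Mem (Ultrapower.mk U g) ↔ ∀ᶠ a in U, f a ∈ g a := by
  have h := relMap_quotient_mk' (L := langMem) (s := (U : Filter I).productSetoid _)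
    (ps := Ultraproduct.setoidPrestructure (fun _ => ZFSet.{u}) U) (n := 2) MemRel.mem ![f, g]
  have e : (fun i => (Quotient.mk ((U : Filter I).productSetoid fun _ => ZFSet.{u}) (![f, g] i)))
      = ![Ultrapower.mk U f, Ultrapower.mk U g] := by
    funext i; fin_cases i <;> rfl
  rw [e] at h
  exact h

/-- By countable completeness, the representatives of a descending chain descend simultaneously at
some single index. -/
theorem Ultrapower.mem_wf [CountableInterFilter (U : Filter I)] :
    WellFounded (Ultrapower.Mem (U := U)) := by
  rw [wellFounded_iff_isEmpty_descending_chain]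
  refine ⟨fun ⟨x, hx⟩ => ?_⟩
  choose f hf using fun n => Quotient.exists_rep (x n)
  have h : ∀ᶠ a in (U : Filter I), ∀ n, f (n + 1) a ∈ f n a := by
    rw [eventually_countable_forall]
    intro n
    have := hx n
    rw [← hf n, ← hf (n + 1)] at this
    exact Ultrapower.mem_mk.1 this
  obtain ⟨a, ha⟩ := h.exists
  exact (wellFounded_iff_isEmpty_descending_chain.1 ZFSet.mem_wf).false ⟨fun n => f n a, ha⟩

theorem Ultrapower.eventually_subset {f g : I → ZFSet.{u}}
    (h : ∀ z : Ultrapower U, z.Mem (Ultrapower.mk U f) → z.Mem (Ultrapower.mk U g)) :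
    ∀ᶠ a in U, f a ⊆ g a := by
  by_contra hne
  rw [← Ultrafilter.eventually_not] at hne
  have hw : ∀ a, ∃ z, ¬ f a ⊆ g a → z ∈ f a ∧ z ∉ g a := by
    intro a
    by_cases ha : f a ⊆ g a
    · exact ⟨∅, fun h => (h ha).elim⟩
    · obtain ⟨z, hz⟩ := Set.not_subset.1 ha
      exact ⟨z, fun _ => hz⟩
  choose k hk using hw
  have h1 := mem_mk.1 (h (mk U k) (mem_mk.2 (hne.mono fun a ha => (hk a ha).1)))
  obtain ⟨a, ha, ha'⟩ := (hne.and h1).exists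
  exact (hk a ha).2 ha'

theorem Ultrapower.ext {x y : Ultrapower U} (h : ∀ z : Ultrapower U, z.Mem x ↔ z.Mem y) :
    x = y := by
  induction x using Ultrapower.ind with | h f
  induction y using Ultrapower.ind with | h g
  rw [mk_eq_mk]
  exact ((eventually_subset fun z => (h z).1).and (eventually_subset fun z => (h z).2)).mono
    fun a ha => subset_antisymm ha.1 ha.2

/-- Each member of the class of `f` is represented by a selector from the sets `f a ∪ {∅}`, and
these selectors form a small product; `∅` is the default value off the large set. -/
instance Ultrapower.small_mem (x : Ultrapower U) : Small.{u} {y : Ultrapower U // y.Mem x} := by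
  classical
  induction x using Ultrapower.ind with | h f
  let F : (∀ a, (insert ∅ (f a) : ZFSet.{u})) → Ultrapower U := fun g => mk U fun a => g a
  refine small_subset (s := Set.range F) (t := {y | y.Mem (mk U f)}) fun y hy => ?_
  induction y using Ultrapower.ind with | h g
  have hg := mem_mk.1 (Set.mem_ofPred_eq.mp hy)
  refine ⟨fun a => if h : g a ∈ f a then ⟨g a, ZFSet.mem_insert_iff.2 (Or.inr h)⟩
    else ⟨∅, ZFSet.mem_insert_iff.2 (Or.inl rfl)⟩, ?_⟩
  refine mk_eq_mk.2 (hg.mono fun a ha => ?_)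
  simp [ha]

variable [CountableInterFilter (U : Filter I)]

/-- The Mostowski collapse of the ultrapower. -/
noncomputable def Ultrapower.collapse : Ultrapower U → ZFSet.{u} :=
  Ultrapower.mem_wf.fix fun x ih => ZFSet.range fun y : {y : Ultrapower U // y.Mem x} => ih y y.2

theorem Ultrapower.mem_collapse {x : Ultrapower U} {z : ZFSet.{u}} :
    z ∈ x.collapse ↔ ∃ y : Ultrapower U, y.Mem x ∧ y.collapse = z := by
  rw [collapse, WellFounded.fix_eq, ZFSet.mem_range]
  simp

theorem Ultrapower.collapse_injective :
    Function.Injective (Ultrapower.collapse : Ultrapower U → ZFSet.{u}) := by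
  intro x
  refine Ultrapower.mem_wf.induction (C := fun x : Ultrapower U => ∀ ⦃y⦄,
    collapse x = collapse y → x = y) x fun x ih y hxy => ?_
  refine ext fun z => ⟨fun hz => ?_, fun hz => ?_⟩
  · obtain ⟨w, hw, hwz⟩ := mem_collapse.1 (hxy ▸ mem_collapse.2 ⟨z, hz, rfl⟩)
    rwa [ih z hz hwz.symm]
  · obtain ⟨w, hw, hwz⟩ := mem_collapse.1 (hxy ▸ mem_collapse.2 ⟨z, hz, rfl⟩)
    rwa [← ih w hw hwz]

theorem Ultrapower.collapse_mem_collapse {x y : Ultrapower U} :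
    x.collapse ∈ y.collapse ↔ x.Mem y := by
  refine ⟨fun h => ?_, fun h => mem_collapse.2 ⟨x, h, rfl⟩⟩
  obtain ⟨w, hw, hwx⟩ := mem_collapse.1 h
  rwa [← collapse_injective hwx]

/-! ### Absoluteness -/

theorem realize_memF_last {M : Type*} [langMem.Structure M] {α : Type} {n : ℕ} (b : α ⊕ Fin n)
    (v : α → M) (xs : Fin n → M) (z : M) :
    (memF (Sum.inr (Fin.last n)) (Sum.map id Fin.castSucc b)).Realize v (Fin.snoc xs z) ↔
      Structure.RelMap (L := langMem) (n := 2) MemRel.mem ![z, Sum.elim v xs b] := by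
  refine iff_of_eq (congrArg (Structure.RelMap (L := langMem) (n := 2) MemRel.mem) ?_)
  funext i
  fin_cases i
  · simp
  · rcases b with b | b <;> simp

theorem realize_ballF {M : Type*} [langMem.Structure M] {α : Type} {n : ℕ} (b : α ⊕ Fin n)
    (φ : langMem.BoundedFormula α (n + 1)) (v : α → M) (xs : Fin n → M) :
    (ballF b φ).Realize v xs ↔ ∀ z : M,
      Structure.RelMap (L := langMem) (n := 2) MemRel.mem ![z, Sum.elim v xs b] →
        φ.Realize v (Fin.snoc xs z) := by
  simp only [ballF, BoundedFormula.realize_all, BoundedFormula.realize_imp, realize_memF_last]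

theorem realize_bexF {M : Type*} [langMem.Structure M] {α : Type} {n : ℕ} (b : α ⊕ Fin n)
    (φ : langMem.BoundedFormula α (n + 1)) (v : α → M) (xs : Fin n → M) :
    (bexF b φ).Realize v xs ↔ ∃ z : M,
      Structure.RelMap (L := langMem) (n := 2) MemRel.mem ![z, Sum.elim v xs b] ∧
        φ.Realize v (Fin.snoc xs z) := by
  simp only [bexF, BoundedFormula.realize_ex, BoundedFormula.realize_inf, realize_memF_last]

theorem exists_eq_var {α : Type} (t : langMem.Term α) : ∃ a, t = Term.var a := by
  cases t with
  | var a => exact ⟨a, rfl⟩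
  | func f _ => exact f.elim

/-- The collapse is an isomorphism onto a transitive class, so bounded quantifiers range over the
same sets in that class and in `V`. -/
theorem Ultrapower.realize_iff_of_isDeltaZero {α : Type} {n : ℕ} {φ : langMem.BoundedFormula α n}
    (hφ : IsDeltaZero φ) (v : α → Ultrapower U) (xs : Fin n → Ultrapower U) :
    φ.Realize v xs ↔ φ.Realize (fun i => (v i).collapse) (fun i => (xs i).collapse) := by
  have hv : ∀ {n : ℕ} (xs : Fin n → Ultrapower U) (b : α ⊕ Fin n),
      Sum.elim (fun i => (v i).collapse) (fun i => (xs i).collapse) b =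
        (Sum.elim v xs b).collapse := by rintro n xs (b | b) <;> rfl
  have hs : ∀ {n : ℕ} (xs : Fin n → Ultrapower U) (z : Ultrapower U),
      (Fin.snoc (fun i => (xs i).collapse) z.collapse : Fin (n + 1) → ZFSet.{u}) =
        fun i => ((Fin.snoc xs z : Fin (n + 1) → Ultrapower U) i).collapse := by
    intro n xs z
    funext i
    refine Fin.lastCases ?_ (fun i => ?_) i <;> simp
  induction hφ with
  | falsum => rfl
  | equal t₁ t₂ =>
    obtain ⟨a, rfl⟩ := exists_eq_var t₁
    obtain ⟨b, rfl⟩ := exists_eq_var t₂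
    change Sum.elim v xs a = Sum.elim v xs b ↔ Sum.elim _ _ a = Sum.elim _ _ b
    rw [hv, hv, collapse_injective.eq_iff]
  | @rel n l R ts =>
    cases R
    obtain ⟨a, ha⟩ := exists_eq_var (ts 0)
    obtain ⟨b, hb⟩ := exists_eq_var (ts 1)
    obtain rfl : ts = ![Term.var a, Term.var b] := by
      funext i; fin_cases i <;> assumption
    have h1 : (FirstOrder.Language.BoundedFormula.rel (L := langMem) (l := 2) MemRel.mem
      ![Term.var a, Term.var b]).Realize v xs ↔ (Sum.elim v xs a).Mem (Sum.elim v xs b) := by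
      refine iff_of_eq (congrArg (Structure.RelMap (L := langMem) (n := 2) MemRel.mem) ?_)
      funext i; fin_cases i <;> rfl
    rw [h1, ← collapse_mem_collapse, ← hv, ← hv]
    rfl
  | imp _ _ ih₁ ih₂ =>
    exact imp_congr (ih₁ xs) (ih₂ xs)
  | ball b _ ih =>
    rw [realize_ballF, realize_ballF, hv]
    constructor
    · intro h z hz
      obtain ⟨y, hy, rfl⟩ := mem_collapse.1 hz
      rw [hs]
      exact (ih _).1 (h y hy)
    · intro h z hz
      refine (ih _).2 ?_
      rw [← hs]
      exact h _ (collapse_mem_collapse.2 hz)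
  | bex b _ ih =>
    rw [realize_bexF, realize_bexF, hv]
    constructor
    · rintro ⟨z, hz, h⟩
      have h := (ih _).1 h
      rw [← hs] at h
      exact ⟨_, collapse_mem_collapse.2 hz, h⟩
    · rintro ⟨z, hz, h⟩
      obtain ⟨y, hy, rfl⟩ := mem_collapse.1 hz
      rw [hs] at h
      exact ⟨y, hy, (ih _).2 h⟩

theorem Ultrapower.realize_of_isSigmaOne {α : Type} {n : ℕ} {φ : langMem.BoundedFormula α n}
    (hφ : IsSigmaOne φ) {v : α → Ultrapower U} {xs : Fin n → Ultrapower U}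
    (h : φ.Realize v xs) :
    φ.Realize (fun i => (v i).collapse) (fun i => (xs i).collapse) := by
  induction hφ with
  | of_deltaZero hφ => exact (realize_iff_of_isDeltaZero hφ _ _).1 h
  | ex _ ih =>
    rw [BoundedFormula.realize_ex] at h ⊢
    obtain ⟨z, hz⟩ := h
    refine ⟨z.collapse, ?_⟩
    convert ih hz using 1
    funext i
    refine Fin.lastCases ?_ (fun i => ?_) i <;> simp

/-- `Σ₁`-formulas that hold almost everywhere hold of the collapsed classes. -/
theorem Ultrapower.realize_collapse_of_eventually {α : Type} {φ : langMem.Formula α}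
    (hφ : IsSigmaOne φ) (f : α → I → ZFSet.{u}) (h : ∀ᶠ a in U, φ.Realize fun i => f i a) :
    φ.Realize fun i => (mk U (f i)).collapse := by
  have h1 := (Ultraproduct.realize_formula_cast (u := U) φ f).2 h
  have h2 := realize_of_isSigmaOne (xs := fun i => i.elim0) hφ h1
  have e : ∀ (w : α → ZFSet.{u}) (ys zs : Fin 0 → ZFSet.{u}),
      BoundedFormula.Realize φ w ys → BoundedFormula.Realize φ w zs := fun w ys zs h => by
    rwa [Subsingleton.elim zs ys]
  exact e _ _ _ h2

end Collapse

/-! ### Represented sets and ordinals, and fixed points of the embedding -/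

section Values

variable {I : Type u} (U : Ultrafilter I) [CountableInterFilter (U : Filter I)]

/-- The set represented by a function `f` in the transitive collapse of the ultrapower. -/
noncomputable def ultraVal (f : I → ZFSet.{u}) : ZFSet.{u} := (Ultrapower.mk U f).collapse

/-- The ordinal represented by a function `f` in the transitive collapse of the ultrapower. -/
noncomputable def ultraOrd (f : I → Ordinal.{u}) : Ordinal.{u} :=
  (ultraVal U fun a => (f a).toZFSet).rank

variable {U}

theorem ultraVal_mem {f g : I → ZFSet.{u}} :
    ultraVal U f ∈ ultraVal U g ↔ ∀ᶠ a in U, f a ∈ g a :=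
  Ultrapower.collapse_mem_collapse.trans Ultrapower.mem_mk

theorem ultraVal_inj {f g : I → ZFSet.{u}} :
    ultraVal U f = ultraVal U g ↔ ∀ᶠ a in U, f a = g a :=
  Ultrapower.collapse_injective.eq_iff.trans Ultrapower.mk_eq_mk

theorem mem_ultraVal {f : I → ZFSet.{u}} {z : ZFSet.{u}} :
    z ∈ ultraVal U f ↔ ∃ g, (∀ᶠ a in U, g a ∈ f a) ∧ ultraVal U g = z := by
  refine Ultrapower.mem_collapse.trans ⟨?_, ?_⟩
  · rintro ⟨y, hy, h⟩
    induction y using Ultrapower.ind with | h g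
    exact ⟨g, Ultrapower.mem_mk.1 hy, h⟩
  · rintro ⟨g, hg, h⟩
    exact ⟨_, Ultrapower.mem_mk.2 hg, h⟩

theorem ultraVal_subset {f g : I → ZFSet.{u}} (h : ∀ᶠ a in U, f a ⊆ g a) :
    ultraVal U f ⊆ ultraVal U g := by
  intro z hz
  obtain ⟨k, hk, rfl⟩ := mem_ultraVal.1 hz
  exact ultraVal_mem.2 ((hk.and h).mono fun a ha => ha.2 ha.1)

theorem ultraVal_sdiff (f g : I → ZFSet.{u}) :
    (ultraVal U fun a => f a \ g a) = ultraVal U f \ ultraVal U g := by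
  ext z
  rw [ZFSet.mem_sdiff]
  constructor
  · intro hz
    obtain ⟨k, hk, rfl⟩ := mem_ultraVal.1 hz
    rw [ultraVal_mem, ultraVal_mem, ← Ultrafilter.eventually_not, ← eventually_and]
    simpa using hk
  · rintro ⟨hz, hz'⟩
    obtain ⟨k, hk, rfl⟩ := mem_ultraVal.1 hz
    rw [ultraVal_mem, ← Ultrafilter.eventually_not] at hz'
    rw [ultraVal_mem]
    simpa using hk.and hz'

theorem isOrdinal_ultraVal (f : I → Ordinal.{u}) :
    (ultraVal U fun a => (f a).toZFSet).IsOrdinal := by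
  constructor
  · intro y hy z hz
    obtain ⟨g, hg, rfl⟩ := mem_ultraVal.1 hy
    obtain ⟨k, hk, rfl⟩ := mem_ultraVal.1 hz
    exact ultraVal_mem.2 ((hg.and hk).mono fun a ha =>
      (ZFSet.isOrdinal_toZFSet _).mem_trans ha.2 ha.1)
  · intro x y z hx hy hz
    obtain ⟨l, hl, rfl⟩ := mem_ultraVal.1 hz
    obtain ⟨k, hk, rfl⟩ := mem_ultraVal.1 hy
    obtain ⟨g, hg, rfl⟩ := mem_ultraVal.1 hx
    exact ultraVal_mem.2 ((hl.and (hk.and hg)).mono fun a ha =>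
      ((ZFSet.isOrdinal_toZFSet _).mem ha.1).mem_trans ha.2.2 ha.2.1)

theorem toZFSet_ultraOrd (f : I → Ordinal.{u}) :
    (ultraOrd U f).toZFSet = ultraVal U fun a => (f a).toZFSet :=
  (isOrdinal_ultraVal f).toZFSet_rank_eq

theorem ultraOrd_lt {f g : I → Ordinal.{u}} :
    ultraOrd U f < ultraOrd U g ↔ ∀ᶠ a in U, f a < g a := by
  rw [← Ordinal.toZFSet_mem_toZFSet_iff, toZFSet_ultraOrd, toZFSet_ultraOrd, ultraVal_mem]
  simp only [Ordinal.toZFSet_mem_toZFSet_iff]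

theorem ultraOrd_le {f g : I → Ordinal.{u}} :
    ultraOrd U f ≤ ultraOrd U g ↔ ∀ᶠ a in U, f a ≤ g a := by
  rw [← not_lt, ultraOrd_lt, ← Ultrafilter.eventually_not]
  simp only [not_lt]

theorem ultraOrd_inj {f g : I → Ordinal.{u}} :
    ultraOrd U f = ultraOrd U g ↔ ∀ᶠ a in U, f a = g a := by
  simp only [le_antisymm_iff, ultraOrd_le, eventually_and]

theorem exists_ultraOrd_eq {α β : Ordinal.{u}} (h : α < ultraOrd U fun _ => β) :
    ∃ f : I → Ordinal.{u}, (∀ a, f a < β) ∧ ultraOrd U f = α := by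
  rw [← Ordinal.toZFSet_mem_toZFSet_iff, toZFSet_ultraOrd] at h
  obtain ⟨g, hg, hgα⟩ := mem_ultraVal.1 h
  simp only [Ordinal.mem_toZFSet_iff] at hg
  have hβ : 0 < β := by
    obtain ⟨a, b, hb, -⟩ := hg.exists
    exact hb.bot_lt
  -- The default value `0` makes the representing function bounded by `β` everywhere, not just
  -- almost everywhere.
  have hw : ∀ a, ∃ b < β, (∃ b < β, b.toZFSet = g a) → b.toZFSet = g a := by
    intro a
    by_cases ha : ∃ b < β, b.toZFSet = g a
    · obtain ⟨b, hb, hba⟩ := ha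
      exact ⟨b, hb, fun _ => hba⟩
    · exact ⟨0, hβ, fun h => (ha h).elim⟩
  choose f hf hfg using hw
  refine ⟨f, hf, Ordinal.toZFSet_injective ?_⟩
  rw [toZFSet_ultraOrd, ← hgα, ultraVal_inj]
  exact hg.mono hfg

theorem le_ultraOrd_const (β : Ordinal.{u}) : β ≤ ultraOrd U fun _ => β :=
  StrictMono.le_apply (f := fun β => ultraOrd U fun _ => β)
    fun _ _ h => ultraOrd_lt.2 (Eventually.of_forall fun _ => h)

theorem exists_ultraOrd_toOrd {β : Ordinal.{u}} (α : (ultraOrd U fun _ => β).ToType) :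
    ∃ f : I → β.ToType, ultraOrd U (fun a => ((f a).toOrd : Ordinal)) = α.toOrd := by
  obtain ⟨f, hf, h⟩ := exists_ultraOrd_eq (Set.mem_Iio.1 α.toOrd.2)
  exact ⟨fun a => Ordinal.ToType.mk ⟨f a, hf a⟩, by simpa using h⟩

theorem card_ultraOrd_const_le (β : Ordinal.{u}) :
    (ultraOrd U fun _ => β).card ≤ β.card ^ #I := by
  choose F hF using exists_ultraOrd_toOrd (U := U) (β := β)
  have hinj : Function.Injective F := by
    intro α α' h
    have h' := hF α
    rw [h, hF α'] at h'
    exact (Ordinal.ToType.mk.symm.injective (Subtype.ext h')).symm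
  simpa using mk_le_of_injective hinj

theorem card_ultraOrd_const_mono {β γ : Ordinal.{u}} (h : β.card ≤ γ.card) :
    (ultraOrd U fun _ => β).card ≤ (ultraOrd U fun _ => γ).card := by
  obtain ⟨e⟩ : Nonempty (β.ToType ↪ γ.ToType) := by
    rwa [← Cardinal.le_def, mk_toType, mk_toType]
  choose F hF using exists_ultraOrd_toOrd (U := U) (β := β)
  have hlt : ∀ α, ultraOrd U (fun a => ((e (F α a)).toOrd : Ordinal)) < ultraOrd U fun _ => γ :=
    fun α => ultraOrd_lt.2 (Eventually.of_forall fun a => (e (F α a)).toOrd.2)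
  have hinj : Function.Injective fun α => Ordinal.ToType.mk ⟨_, hlt α⟩ := by
    intro α α' h
    have h1 := ultraOrd_inj.1 (congrArg Subtype.val (Ordinal.ToType.mk.injective h))
    have h2 : ((α.toOrd : Ordinal)) = α'.toOrd := by
      rw [← hF, ← hF, ultraOrd_inj]
      refine h1.mono fun a ha => ?_
      rw [e.injective (Ordinal.ToType.mk.symm.injective (Subtype.ext ha))]
    exact Ordinal.ToType.mk.symm.injective (Subtype.ext h2)
  simpa using mk_le_of_injective hinj

/-- Any `α < j(μ)` is represented by a function into `μ`; bounding it almost everywhere by a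
constant `β < μ` gives `α ≤ j(β) < μ`. -/
theorem ultraOrd_const_ord_eq {μ : Cardinal.{u}}
    (hb : ∀ f : I → Ordinal.{u}, (∀ a, f a < μ.ord) → ∃ β < μ.ord, ∀ᶠ a in U, f a ≤ β)
    (hc : ∀ β < μ.ord, (ultraOrd U fun _ => β).card < μ) :
    (ultraOrd U fun _ => μ.ord) = μ.ord := by
  refine le_antisymm (le_of_forall_lt fun α hα => ?_) (le_ultraOrd_const _)
  obtain ⟨f, hf, rfl⟩ := exists_ultraOrd_eq hα
  obtain ⟨β, hβ, hfβ⟩ := hb f hf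
  exact (ultraOrd_le.2 hfβ).trans_lt (lt_ord.2 (hc β hβ))

end Values

/-! ### The embedding fixes `ν` and `ν⁺` -/

section Cardinals

variable {I : Type u} {U : Ultrafilter I}

theorem exists_eventually_le_of_cof_ne {δ : Cardinal.{u}} (hI : #I = δ)
    [CardinalInterFilter (U : Filter I) δ] {o : Ordinal.{u}} (ho : o.cof ≠ δ)
    {f : I → Ordinal.{u}} (hf : ∀ a, f a < o) : ∃ β < o, ∀ᶠ a in U, f a ≤ β := by
  rcases lt_or_gt_of_ne ho with h | h
  · obtain ⟨s, hs, hso⟩ := Order.exists_cof_eq (α := o.ToType)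
    rw [Ordinal.cof_toType] at hso
    by_contra! hne
    -- Fewer than `δ` cofinal points are involved, so `δ`-completeness gives one index at which `f`
    -- exceeds them all.
    have h1 : ∀ᶠ a in (U : Filter I), ∀ t : s, (t.1.toOrd : Ordinal) < f a := by
      rw [eventually_cardinal_forall (c := δ) (hso ▸ h)]
      intro t
      exact hne t.1.toOrd t.1.toOrd.2
    obtain ⟨a, ha⟩ := h1.exists
    obtain ⟨t, ht, hat⟩ := hs (Ordinal.ToType.mk ⟨f a, hf a⟩)
    have h2 := Ordinal.ToType.mk.symm.monotone hat
    rw [OrderIso.symm_apply_apply] at h2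
    exact (ha ⟨t, ht⟩).not_ge h2
  · exact ⟨⨆ a, f a, Ordinal.iSup_lt_of_lt_cof (hI ▸ h) hf,
      Eventually.of_forall fun a => Ordinal.le_iSup f a⟩

variable [CountableInterFilter (U : Filter I)]

theorem ultraOrd_const_ord_of_isInaccessibleRelTo {δ ν : Cardinal.{u}} (hI : #I = δ)
    [CardinalInterFilter (U : Filter I) δ] (hν : IsInaccessibleRelTo δ ν) (hcof : ν.ord.cof ≠ δ) :
    (ultraOrd U fun _ => ν.ord) = ν.ord := by
  refine ultraOrd_const_ord_eq (fun f hf => exists_eventually_le_of_cof_ne hI hcof hf)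
    fun β hβ => (card_ultraOrd_const_le β).trans_lt ?_
  rw [hI]
  exact hν.2 _ (lt_ord.1 hβ)

/-- For `β < ν⁺`, an injection of `β` into `ν` yields `|j(β)| ≤ |j(ν)| = ν`. -/
theorem ultraOrd_const_ord_succ {δ ν : Cardinal.{u}} (hI : #I = δ)
    [CardinalInterFilter (U : Filter I) δ] (hδ : ℵ₀ ≤ δ) (hν : δ < ν)
    (h : (ultraOrd U fun _ => ν.ord) = ν.ord) :
    (ultraOrd U fun _ => (Order.succ ν).ord) = (Order.succ ν).ord := by
  refine ultraOrd_const_ord_eq (fun f hf => exists_eventually_le_of_cof_ne hI ?_ hf)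
    fun β hβ => ?_
  · rw [(isRegular_succ (hδ.trans hν.le)).cof_ord]
    exact (hν.trans (Order.lt_succ ν)).ne'
  · refine Order.lt_succ_of_le ((card_ultraOrd_const_mono (γ := ν.ord) ?_).trans ?_)
    · rw [card_ord]
      exact Order.le_of_lt_succ (lt_ord.1 hβ)
    · rw [h, card_ord]

end Cardinals

/-! ### A set omitted by the ultrapower -/

section NotMem

variable {I : Type u} {U : Ultrafilter I}

/-- Otherwise, bounds for `G a ∩ L` at the bad indices have a supremum below `L`, yet this supremum
lies in almost every `G a`. -/
theorem eventually_unbounded {L : Ordinal.{u}} (hL : #I < L.cof) {G : I → Set Ordinal.{u}}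
    (hG : ∀ α < L, ∀ᶠ a in U, α ∈ G a) :
    ∀ᶠ a in U, ∀ β < L, ∃ γ ∈ G a, β ≤ γ ∧ γ < L := by
  have hL0 : 0 < L := Ordinal.cof_pos.1 (bot_le.trans_lt hL)
  by_contra hne
  rw [← Ultrafilter.eventually_not] at hne
  have hw : ∀ a, ∃ β < L, (¬ ∀ β < L, ∃ γ ∈ G a, β ≤ γ ∧ γ < L) → ∀ γ ∈ G a, γ < L → γ < β := by
    intro a
    by_cases ha : ∀ β < L, ∃ γ ∈ G a, β ≤ γ ∧ γ < L
    · exact ⟨0, hL0, fun h => (h ha).elim⟩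
    · have ha' := ha
      push Not at ha'
      obtain ⟨β, hβ, h⟩ := ha'
      exact ⟨β, hβ, fun _ γ hγ hγL => not_le.1 fun hle => (h γ hγ hle).not_gt hγL⟩
  choose g hgL hg using hw
  have hs := Ordinal.iSup_lt_of_lt_cof hL hgL
  obtain ⟨a, ha, ha'⟩ := (hne.and (hG _ hs)).exists
  exact (hg a ha _ ha' hs).not_ge (Ordinal.le_iSup g a)

/-- Recursion along a wellordering of `I` picks `f a ∈ G a` above all earlier values. Then `f` is
injective on a large set, so nonprincipality prevents it from being constant almost everywhere. -/
theorem exists_eventually_mem_not_const (hU : ∀ a, U ≠ pure a) {L : Ordinal.{u}}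
    (hL : #I < L.cof) {G : I → Set Ordinal.{u}} (hG : ∀ α < L, ∀ᶠ a in U, α ∈ G a) :
    ∃ f : I → Ordinal.{u}, (∀ᶠ a in U, f a ∈ G a) ∧ ∀ α, ¬ ∀ᶠ a in U, f a = α := by
  classical
  have hL0 : 0 < L := Ordinal.cof_pos.1 (bot_le.trans_lt hL)
  have hwf : WellFounded (WellOrderingRel (α := I)) := WellOrderingRel.isWellOrder.wf
  let C : (a : I) → (∀ b, WellOrderingRel b a → Ordinal.{u}) → Ordinal.{u} → Prop :=
    fun a ih γ => γ ∈ G a ∧ γ < L ∧ ∀ b hb, ih b hb < γ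
  let f : I → Ordinal.{u} := hwf.fix fun a ih => if h : ∃ γ, C a ih γ then h.choose else 0
  have hf : ∀ a, f a = if h : ∃ γ, C a (fun b _ => f b) γ then h.choose else 0 :=
    fun a => hwf.fix_eq _ a
  have hfL : ∀ a, f a < L := by
    intro a
    rw [hf a]
    split_ifs with h
    · exact h.choose_spec.2.1
    · exact hL0
  have hgood : ∀ᶠ a in U, C a (fun b _ => f b) (f a) := by
    refine (eventually_unbounded hL hG).mono fun a ha => ?_
    -- The whole range of `f` is bounded below `L`, so a single bound serves all predecessors of
    -- `a`.
    obtain ⟨γ, hγ, hle, hγL⟩ := ha _ (Ordinal.iSup_add_one_lt_of_lt_cof hL hfL)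
    have hex : ∃ γ, C a (fun b _ => f b) γ :=
      ⟨γ, hγ, hγL, fun b _ => (Ordinal.lt_iSup_add_one f b).trans_le hle⟩
    have hfa := hf a
    rw [dif_pos hex] at hfa
    rw [hfa]
    exact hex.choose_spec
  refine ⟨f, hgood.mono fun a ha => ha.1, fun α hα => ?_⟩
  have hsub : {a | C a (fun b _ => f b) (f a) ∧ f a = α}.Subsingleton := by
    rintro a ⟨ha, haα⟩ b ⟨hb, hbα⟩
    rcases trichotomous_of WellOrderingRel a b with h | h | h
    · exact ((hb.2.2 a h).ne (haα.trans hbα.symm)).elim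
    · exact h
    · exact ((ha.2.2 b h).ne (hbα.trans haα.symm)).elim
  obtain ⟨a, -, ha⟩ := Ultrafilter.eq_pure_of_finite_mem hsub.finite (hgood.and hα)
  exact hU a ha

variable [CountableInterFilter (U : Filter I)]

/-- If `cof L` exceeds the size of the index set, then the pointwise image of `L` under the
ultrapower embedding does not belong to the ultrapower. -/
theorem ne_ultraVal_image (hU : ∀ a, U ≠ pure a) {L : Ordinal.{u}} (hL : #I < L.cof)
    {B : ZFSet.{u}} (hB : ∀ z, z ∈ B ↔ ∃ α < L, (ultraOrd U fun _ => α).toZFSet = z)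
    (F : I → ZFSet.{u}) : ultraVal U F ≠ B := by
  rintro rfl
  obtain ⟨f, hf, hfc⟩ := exists_eventually_mem_not_const hU hL
    (G := fun a => {α | α.toZFSet ∈ F a}) fun α hα => by
      have h := (hB _).2 ⟨α, hα, rfl⟩
      rwa [toZFSet_ultraOrd, ultraVal_mem] at h
  obtain ⟨α, -, h⟩ := (hB (ultraVal U fun a => (f a).toZFSet)).1 (ultraVal_mem.2 hf)
  rw [← toZFSet_ultraOrd] at h
  exact hfc α (ultraOrd_inj.1 (Ordinal.toZFSet_injective h.symm))

end NotMem

/-! ### Good wellorderings and the ultrapower -/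

section InitialSegments

variable {X : ZFSet.{u}} {r : X → X → Prop}

theorem mem_initialSegment {x : ZFSet.{u}} {y : X} :
    x ∈ initialSegment r y ↔ ∃ hx : x ∈ X, r ⟨x, hx⟩ y := by
  rw [initialSegment, ZFSet.mem_sep]
  exact ⟨fun h => h.2, fun h => ⟨h.1, h⟩⟩

variable {I : Type u} {U : Ultrafilter I} [CountableInterFilter (U : Filter I)]

theorem ultraVal_mem_of_isSigmaOneDefinable {K : ZFSet.{u}} (hK : ultraVal U (fun _ => K) = K)
    {S : Set ZFSet.{u}} (hS : IsSigmaOneDefinable ![K] S) {f : I → ZFSet.{u}}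
    (hf : ∀ᶠ a in U, f a ∈ S) : ultraVal U f ∈ S := by
  obtain ⟨φ, hφ, rfl⟩ := hS
  have h := Ultrapower.realize_collapse_of_eventually (U := U) hφ
    (Fin.cons f ![fun _ => K] : Fin 2 → I → ZFSet.{u}) (hf.mono fun a ha => by
      convert (Set.mem_ofPred_eq.mp ha : φ.Realize _) using 1
      funext i; fin_cases i <;> rfl)
  change φ.Realize _
  convert h using 1
  funext i
  fin_cases i
  · rfl
  · exact hK.symm

/-- Everything but the maximum of a good `Σ₁(K)`-wellordering of `𝒫(K)` belongs to every
ultrapower that fixes `K`. -/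
theorem exists_ultraVal_eq_of_lt {K : ZFSet.{u}} (hK : ultraVal U (fun _ => K) = K)
    {r : K.powerset → K.powerset → Prop} (hr : IsGoodSigmaOneWellOrdering ![K] K.powerset r)
    {x y : K.powerset} (hxy : r x y) : ∃ f, ultraVal U f = x := by
  have := hr.isWellOrder
  have hJ : ∀ x : K.powerset, ultraVal U (fun _ => x) ∈ K.powerset := by
    intro x
    rw [ZFSet.mem_powerset]
    refine (ultraVal_subset (Eventually.of_forall fun _ => ?_)).trans hK.subset
    exact ZFSet.mem_powerset.1 x.2
  let J : K.powerset → K.powerset := fun x => ⟨ultraVal U fun _ => x, hJ x⟩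
  have hseg : ∀ y, ∃ z, (ultraVal U fun _ => initialSegment r y) = initialSegment r z := fun y =>
    ultraVal_mem_of_isSigmaOneDefinable hK hr.definable (Eventually.of_forall fun _ => ⟨y, rfl⟩)
  have hlt : ∀ {x y z}, (ultraVal U fun _ => initialSegment r y) = initialSegment r z →
      (r (J x) z ↔ r x y) := by
    intro x y z hz
    have h : ultraVal U (fun _ => (x : ZFSet.{u})) ∈ initialSegment r z ↔
        (x : ZFSet.{u}) ∈ initialSegment r y := by
      rw [← hz, ultraVal_mem, eventually_const]
    rw [mem_initialSegment, mem_initialSegment] at h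
    exact ⟨fun h' => (h.1 ⟨_, h'⟩).2, fun h' => (h.2 ⟨_, h'⟩).2⟩
  have hmono : ∀ {x y}, r x y → r (J x) (J y) := by
    intro x y h
    obtain ⟨z, hz⟩ := hseg y
    have h1 := (hlt hz).2 h
    have h2 : ¬ r (J y) z := fun h' => irrefl_of r y ((hlt hz).1 h')
    rcases trichotomous_of r (J x) (J y) with h3 | h3 | h3
    · exact h3
    · exact (h2 (h3 ▸ h1)).elim
    · exact (h2 (_root_.trans h3 h1)).elim
  -- A least `x` with `J x ◁ x` is impossible, since then also `J (J x) ◁ J x`.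
  have hle : ∀ x, ¬ r (J x) x := fun x =>
    IsWellFounded.induction r (motive := fun x => ¬ r (J x) x) x fun x ih h => ih _ h (hmono h)
  obtain ⟨z, hz⟩ := hseg y
  have hxz : r x z := by
    have h1 := (hlt hz).2 hxy
    rcases trichotomous_of r x (J x) with h3 | h3 | h3
    · exact _root_.trans h3 h1
    · rwa [← h3] at h1
    · exact (hle x h3).elim
  have hx : (x : ZFSet.{u}) ∈ ultraVal U fun _ => initialSegment r y := by
    rw [hz, mem_initialSegment]
    exact ⟨x.2, hxz⟩
  obtain ⟨f, -, hf⟩ := mem_ultraVal.1 hx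
  exact ⟨f, hf⟩

/-- A subset of `K` omitted by an ultrapower that fixes `K`, and hence with omitted complement,
excludes good `Σ₁(K)`-wellorderings of `𝒫(K)`. -/
theorem not_isGoodSigmaOneWellOrdering {K : ZFSet.{u}} (hK : ultraVal U (fun _ => K) = K)
    {B : ZFSet.{u}} (hBK : B ⊆ K) (hB : ∀ F, ultraVal U F ≠ B)
    (r : K.powerset → K.powerset → Prop) : ¬ IsGoodSigmaOneWellOrdering ![K] K.powerset r := by
  intro hr
  have := hr.isWellOrder
  have hcompl : K \ (K \ B) = B := by
    ext z
    simp only [ZFSet.mem_sdiff]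
    have := @hBK z
    tauto
  have hB' : ∀ F, ultraVal U F ≠ K \ B := by
    intro F hF
    apply hB fun a => K \ F a
    rw [ultraVal_sdiff, hK, hF, hcompl]
  let b : K.powerset := ⟨B, ZFSet.mem_powerset.2 hBK⟩
  let b' : K.powerset := ⟨K \ B, ZFSet.mem_powerset.2 fun z hz => (ZFSet.mem_sdiff.1 hz).1⟩
  rcases trichotomous_of r b b' with h | h | h
  · obtain ⟨F, hF⟩ := exists_ultraVal_eq_of_lt hK hr h
    exact hB F hF
  -- `B = K \ B` forces `K = B`, but `K` is represented by a constant function.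
  · have hz : ∀ z, z ∈ B ↔ z ∈ K \ B := fun z => by
      rw [← show B = K \ B from congrArg Subtype.val h]
    have hBeq : K = B := by
      ext z
      have h1 := hz z
      have h2 := @hBK z
      rw [ZFSet.mem_sdiff] at h1
      tauto
    exact hB (fun _ => K) (hK.trans hBeq)
  · obtain ⟨F, hF⟩ := exists_ultraVal_eq_of_lt hK hr h
    exact hB' F hF

end InitialSegments

end SetTheoryGoodWO

/-! ### The main theorem -/

open SetTheoryGoodWO Filter

theorem mainTheorem3 (δ ν κ : Cardinal.{u})
    (hδ : SetTheoryGoodWO.IsMeasurableCardinal δ)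
    (hν : SetTheoryGoodWO.IsInaccessibleRelTo δ ν)
    (hcof : ν.ord.cof ≠ δ)
    (hνκ : ν ≤ κ) (hκν : κ ≤ Order.succ ν) :
    ¬ ∃ r : (SetTheoryGoodWO.cardToZFSet κ).powerset →
          (SetTheoryGoodWO.cardToZFSet κ).powerset → Prop,
        SetTheoryGoodWO.IsGoodSigmaOneWellOrdering ![SetTheoryGoodWO.cardToZFSet κ]
          (SetTheoryGoodWO.cardToZFSet κ).powerset r := by
  rintro ⟨r, hr⟩
  obtain ⟨hω, U, hcomp, hU⟩ := hδ
  have : CountableInterFilter (U : Filter δ.out) :=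
    CardinalInterFilter.toCountableInterFilter (c := δ) (U : Filter δ.out) hω
  have hI : #δ.out = δ := mk_out δ
  have h1 := ultraOrd_const_ord_of_isInaccessibleRelTo (U := U) hI hν hcof
  have hκ : (ultraOrd U fun _ => κ.ord) = κ.ord := by
    rcases hκν.lt_or_eq with h | rfl
    · rwa [hνκ.antisymm (Order.le_of_lt_succ h)] at h1
    · exact ultraOrd_const_ord_succ hI hω.le hν.1 h1
  have hK : ultraVal U (fun _ => cardToZFSet κ) = cardToZFSet κ := by
    rw [cardToZFSet, ← toZFSet_ultraOrd, hκ]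
  -- The ordinal `δ⁺` serves as `L`: it is regular and exceeds the index set, and `δ⁺ ≤ κ` because
  -- `δ < ν ≤ κ`.
  have hL : #δ.out < (Order.succ δ).ord.cof := by
    rw [(isRegular_succ hω.le).cof_ord, hI]
    exact Order.lt_succ δ
  have hLκ : (Order.succ δ).ord ≤ κ.ord := ord_le_ord.2 (Order.succ_le_of_lt (hν.1.trans_le hνκ))
  let B : ZFSet.{u} := ZFSet.sep
    (fun z => ∃ α < (Order.succ δ).ord, (ultraOrd U fun _ => α).toZFSet = z) (cardToZFSet κ)
  refine not_isGoodSigmaOneWellOrdering hK (B := B) ZFSet.sep_subset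
    (ne_ultraVal_image hU hL fun z => ?_) r hr
  rw [ZFSet.mem_sep, and_iff_right_iff_imp]
  rintro ⟨α, hα, rfl⟩
  -- Since `j(α) < j(κ) = κ`, intersecting with `κ` removes nothing from `j''δ⁺`.
  rw [cardToZFSet, Ordinal.toZFSet_mem_toZFSet_iff, ← hκ, ultraOrd_lt]
  exact Eventually.of_forall fun _ => hα.trans_le hLκ
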